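/- **Theorem (Ultraviolet Suppression).** Let $\hbar,e>0$, $\varphi_0=\hbar/(2e)$, let the Josephson energy satisfy $0<E_J<\infty$, and put $L_J=\varphi_0^2/E_J$. Let $Y$ be a positive-real admittance: $Y$ is analytic in $\{\operatorname{Re}s>0\}$, and there $Y(\bar s)=\overline{Y(s)}$ and $\operatorname{Re}Y(s)\ge 0$. Suppose that $Y$ has finite shunt capacitance $C_\Sigma>0$, i.e. $Y(s)=sC_\Sigma+Y_{\rm rem}(s)$ with a remainder that is bounded at high frequency: for some $\sigma\ge 0$, $Y_{\rm rem}(\sigma+i\omega)=O(1)$ as $\omega\to+\infty$. (The case $\sigma=0$ is boundedness on the imaginary axis. Boundedness on a line with $\sigma>0$ also admits lossless environments with infinitely many poles $\pm i\omega_k$ on the axis, for instance $Y(s)=sC+Z_0^{-1}\coth(s\ell/v)$.) The dressed mode frequencies are the $\omega_n>0$ such that $Y$ is analytic at $i\omega_n$ and $sY(s)+1/L_J=0$ at $s=i\omega_n$. With $B(\omega)=\operatorname{Im}Y(i\omega)$, the junction participation $\phi_n^J\ge 0$, the zero-point flux and the dimensionless coupling of the mode are given by $$(\phi_n^J)^2=\frac{2\omega_n}{\frac{d}{d\omega}[\omega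 B(\omega)]\big|_{\omega_n}},\qquad \Phi_n^{J,\mathrm{zpf}}=\phi_n^J\sqrt{\frac{\hbar}{2\omega_n}},\qquad \lambda_n=\frac{\Phi_n^{J,\mathrm{zpf}}}{\varphi_0}.$$ Then the denominator $\frac{d}{d\omega}[\omega B(\omega)]|_{\omega_n}$ is positive for every dressed mode, and: (i) $\phi_n^J=O(\omega_n^{-1})$ as $\omega_n\to\infty$; (ii) $\Phi_n^{J,\mathrm{zpf}}=O(\omega_n^{-3/2})$ as $\omega_n\to\infty$; (iii) $\lambda_n=O(\omega_n^{-3/2})$ as $\omega_n\to\infty$; (iv) the sum $\sum_n\lambda_n^2 f(\omega_n)$ over all dressed modes converges absolutely for every real $k<2$ and every $f:\mathbb R\to\mathbb R$ with $f(\omega)=O(\omega^k)$ as $\omega\to\infty$ that is bounded on the dressed frequencies below each finite cutoff (which is automatic when only finitely many modes lie below each cutoff). -/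

import Mathlib

open Filter Asymptotics
open scoped Topology

namespace CircuitQED

/-- Positive-real function: analytic in the open right half-plane, real (commuting with complex
conjugation) and with non-negative real part there. -/
structure IsPositiveReal (Y : ℂ → ℂ) : Prop where
  analytic : AnalyticOnNhd ℂ Y {s : ℂ | 0 < s.re}
  reality : ∀ s : ℂ, 0 < s.re → Y (starRingEnd ℂ s) = starRingEnd ℂ (Y s)
  re_nonneg : ∀ s : ℂ, 0 < s.re → 0 ≤ (Y s).re

/-- `Y` has shunt capacitance `C` at the port: `Y(s) = s C + Y_rem(s)`, where the remainder stays
bounded at high frequency along some vertical line `s = σ + i ω`, `σ ≥ 0`, `ω → ∞`. The value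
`σ = 0` is the condition on the imaginary axis itself. Lossless networks with infinitely many
modes (such as transmission lines) have poles on that axis, and `σ > 0` measures the size of the
remainder inside the half-plane of analyticity. -/
def HasShuntCapacitance (Y : ℂ → ℂ) (C : ℝ) : Prop :=
  ∃ σ : ℝ, 0 ≤ σ ∧
    (fun ω : ℝ => Y ((σ : ℂ) + (ω : ℂ) * Complex.I) - ((σ : ℂ) + (ω : ℂ) * Complex.I) * (C : ℂ))
      =O[atTop] (fun _ : ℝ => (1 : ℝ))

/-- Reduced flux quantum `φ₀ = ħ / (2 e)`. -/
noncomputable def reducedFluxQuantum (hbar e : ℝ) : ℝ := hbar / (2 * e)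

/-- Josephson inductance `L_J = φ₀² / E_J`. -/
noncomputable def josephsonInductance (hbar e EJ : ℝ) : ℝ := reducedFluxQuantum hbar e ^ 2 / EJ

/-- The dressed mode frequencies: the `ω > 0` such that `s = i ω` is a regular point of `Y` and
solves the boundary condition `s Y(s) + 1 / L_J = 0`. -/
def dressedFrequencies (Y : ℂ → ℂ) (LJ : ℝ) : Set ℝ :=
  {ω : ℝ | 0 < ω ∧ AnalyticAt ℂ Y ((ω : ℂ) * Complex.I) ∧
    ((ω : ℂ) * Complex.I) * Y ((ω : ℂ) * Complex.I) + 1 / (LJ : ℂ) = 0}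

/-- Susceptance `B(ω) = Im Y(i ω)`. -/
noncomputable def susceptance (Y : ℂ → ℂ) (ω : ℝ) : ℝ := (Y ((ω : ℂ) * Complex.I)).im

/-- The slope `d/dω [ω B(ω)]`. -/
noncomputable def susceptanceSlope (Y : ℂ → ℂ) (ω : ℝ) : ℝ :=
  deriv (fun w : ℝ => w * susceptance Y w) ω

/-- Junction participation of the mode at frequency `ω`, in the normalization where the mode has
unit capacitive norm: `(φ^J)² = 2 ω / (d/dω [ω B(ω)])`, with the sign of the mode chosen so that
`φ^J ≥ 0`. -/
noncomputable def junctionParticipation (Y : ℂ → ℂ) (ω : ℝ) : ℝ :=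
  Real.sqrt (2 * ω / susceptanceSlope Y ω)

/-- Zero-point flux at the junction, `Φ^{J,zpf} = φ^J √(ħ / (2 ω))`. -/
noncomputable def zeroPointFlux (hbar : ℝ) (Y : ℂ → ℂ) (ω : ℝ) : ℝ :=
  junctionParticipation Y ω * Real.sqrt (hbar / (2 * ω))

/-- Dimensionless coupling `λ = Φ^{J,zpf} / φ₀`. -/
noncomputable def dimensionlessCoupling (hbar e : ℝ) (Y : ℂ → ℂ) (ω : ℝ) : ℝ :=
  zeroPointFlux hbar Y ω / reducedFluxQuantum hbar e

/-- The filter `ω_n → ∞` along the dressed modes. -/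
def highFrequencyModes (Y : ℂ → ℂ) (LJ : ℝ) : Filter ℝ :=
  atTop ⊓ 𝓟 (dressedFrequencies Y LJ)

end CircuitQED

/-!
Let `D(s) = Y(s) + 1 / (L s)` be the environment in parallel with the junction inductance. In the
open right half-plane `Re D ≥ Re (1 / (L s)) > 0`, so the impedance `Z = 1 / D` is analytic there
with nonnegative real part. A dressed frequency `ω` is a zero of `D` at `i ω`. Since `Re D ≥ 0` on
one side of that point, `D'(i ω)` is real and nonnegative, and the inductor makes it positive; it
equals `1 / ω` times the slope of `ω B(ω)`. Hence `Z` has a simple pole at `i ω` with residue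
`r = ω / slope > 0` (`IsPositiveReal.hasDerivAt_totalAdmittance`), and `(φ^J)² = 2 r`,
`λ² = ħ r / (φ₀² ω)`.

The residues are controlled by Julia's lemma, the boundary limit of the Schwarz–Pick lemma:
`Re Z(s)` dominates `∑ r Re s / |s - i ω|²` over any finite set of modes
(`IsPositiveReal.sum_modeResidue_le`). This is evaluated at two places.

* On the positive real axis `Z(x) = O(x)`, because of the inductor; letting `x → 0` gives
  `∑ r / ω² ≤ L`, which sums the modes below any cutoff even if they accumulate.
* On a line `Re s = σ > 0` on which `Y(s) = s C + O(1)`, the quantity `Re Z = Re D / |D|²` is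
  `O(v⁻²)` at height `v`, so the residues with `v ≤ ω ≤ v + 1` add up to `O(v⁻²)`. If `σ = 0`, the
  capacitor excludes dressed modes at high frequency altogether.

The window bound for a single mode gives `r = O(ω⁻²)`, hence the decay rates; summed over integer
`v`, it gives convergence of `∑ r ω ^ q` for every `q < 1`, hence of `∑ λ² f`.
-/

namespace CircuitQED

/-! ### Boundary atoms of functions with nonnegative real part -/

open ComplexConjugate in
theorem normSq_add_conj (a b : ℂ) :
    Complex.normSq (a + conj b) = Complex.normSq (a - b) + 4 * (a.re * b.re) := by
  simp only [Complex.normSq_apply, Complex.add_re, Complex.add_im, Complex.sub_re, Complex.sub_im,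
    Complex.conj_re, Complex.conj_im]
  ring

open ComplexConjugate in
theorem add_conj_ne_zero {a b : ℂ} (ha : 0 ≤ a.re) (hb : 0 < b.re) : a + conj b ≠ 0 := by
  intro h
  have := congrArg Complex.re h
  simp only [Complex.add_re, Complex.conj_re, Complex.zero_re] at this
  linarith

open ComplexConjugate in
/-- **Schwarz–Pick lemma** in the right half-plane, written without quotients. -/
theorem schwarz_pick_rightHalfPlane {Z : ℂ → ℂ} (hZ : DifferentiableOn ℂ Z {s | 0 < s.re})
    (hre : ∀ s : ℂ, 0 < s.re → 0 ≤ (Z s).re) {s w : ℂ} (hs : 0 < s.re) (hw : 0 < w.re)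
    (hZw : 0 < (Z w).re) :
    s.re * w.re * Complex.normSq (Z s + conj (Z w)) ≤
      (Z s).re * (Z w).re * Complex.normSq (s + conj w) := by
  -- the Möbius map from the unit disc onto the half-plane that sends `0` to `w`
  set m : ℂ → ℂ := fun u => (w + conj w * u) / (1 - u) with hm
  have hu1 : ∀ u : ℂ, ‖u‖ < 1 → 1 - u ≠ 0 := by
    intro u hu h
    rw [← sub_eq_zero.mp h] at hu
    simp at hu
  have hmre : ∀ u : ℂ, ‖u‖ < 1 → 0 < (m u).re := by
    intro u hu
    have hn : Complex.normSq u < 1 := by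
      rw [Complex.normSq_eq_norm_sq]; nlinarith [norm_nonneg u]
    have hpos : 0 < Complex.normSq (1 - u) := Complex.normSq_pos.mpr (hu1 u hu)
    have : (m u).re = w.re * (1 - Complex.normSq u) / Complex.normSq (1 - u) := by
      simp only [hm, Complex.div_re, Complex.add_re, Complex.mul_re, Complex.mul_im,
        Complex.conj_re, Complex.conj_im, Complex.add_im, Complex.sub_re, Complex.sub_im, Complex.one_re,
        Complex.one_im]
      rw [← add_div]
      congr 1
      rw [Complex.normSq_apply]
      ring
    rw [this]
    exact div_pos (mul_pos hw (by linarith)) hpos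
  set g : ℂ → ℂ := fun u => (Z (m u) - Z w) / (Z (m u) + conj (Z w)) with hg
  have hden : ∀ u : ℂ, ‖u‖ < 1 → Z (m u) + conj (Z w) ≠ 0 := fun u hu =>
    add_conj_ne_zero (hre _ (hmre u hu)) hZw
  have hmd : DifferentiableOn ℂ m (Metric.ball 0 1) := by
    refine DifferentiableOn.div (by fun_prop) (by fun_prop) fun u hu => hu1 u (by simpa using hu)
  have hZm : DifferentiableOn ℂ (fun u => Z (m u)) (Metric.ball 0 1) :=
    hZ.comp hmd fun u hu => hmre u (by simpa using hu)
  have hgd : DifferentiableOn ℂ g (Metric.ball 0 1) :=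
    (hZm.sub_const _).div (hZm.add_const _) fun u hu => hden u (by simpa using hu)
  have hgmaps : Set.MapsTo g (Metric.ball 0 1) (Metric.closedBall 0 1) := by
    intro u hu
    have hu' : ‖u‖ < 1 := by simpa using hu
    rw [mem_closedBall_zero_iff, hg, norm_div, div_le_one (norm_pos_iff.mpr (hden u hu')),
      ← sq_le_sq₀ (norm_nonneg _) (norm_nonneg _), ← Complex.normSq_eq_norm_sq,
      ← Complex.normSq_eq_norm_sq, normSq_add_conj]
    nlinarith [mul_nonneg (hre _ (hmre u hu')) hZw.le]
  have hg0 : g 0 = 0 := by simp [hg, hm]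
  have hsw : s + conj w ≠ 0 := add_conj_ne_zero hs.le hw
  have hN : 0 < Complex.normSq (s + conj w) := Complex.normSq_pos.mpr hsw
  have hu : ‖(s - w) / (s + conj w)‖ < 1 := by
    rw [norm_div, div_lt_one (norm_pos_iff.mpr hsw),
      ← sq_lt_sq₀ (norm_nonneg _) (norm_nonneg _), ← Complex.normSq_eq_norm_sq,
      ← Complex.normSq_eq_norm_sq, normSq_add_conj]
    nlinarith [mul_pos hs hw]
  have hmu : m ((s - w) / (s + conj w)) = s := by
    have h1 := hu1 _ hu
    simp only [hm]
    rw [div_eq_iff h1]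
    field_simp
    ring
  have key := Complex.norm_le_norm_of_mapsTo_ball hgd hgmaps hg0 hu
  have hD : Z s + conj (Z w) ≠ 0 := add_conj_ne_zero (hre s hs) hZw
  have hN' : 0 < Complex.normSq (Z s + conj (Z w)) := Complex.normSq_pos.mpr hD
  simp only [hg, hmu] at key
  rw [← sq_le_sq₀ (norm_nonneg _) (norm_nonneg _), ← Complex.normSq_eq_norm_sq,
      ← Complex.normSq_eq_norm_sq, map_div₀, map_div₀, div_le_div_iff₀ hN' hN] at key
  have e1 := normSq_add_conj (Z s) (Z w)
  have e2 := normSq_add_conj s w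
  have e3 : Complex.normSq (Z s - Z w) = Complex.normSq (Z s + conj (Z w)) -
    4 * ((Z s).re * (Z w).re) := by linarith
  have e4 : Complex.normSq (s - w) = Complex.normSq (s + conj w) - 4 * (s.re * w.re) := by linarith
  rw [e3, e4] at key
  linarith

open ComplexConjugate in
/-- **Julia's lemma**: an atom of mass `r` at a boundary point `p` bounds the real part of `Z` from
below by the real part of `r / (s - p)`. It is the limit `w → p` of the Schwarz–Pick lemma. -/
theorem julia_rightHalfPlane {Z : ℂ → ℂ} (hZ : DifferentiableOn ℂ Z {s | 0 < s.re})
    (hre : ∀ s : ℂ, 0 < s.re → 0 ≤ (Z s).re) {p : ℂ} (hp : p.re = 0) {r : ℝ} (hr : 0 < r)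
    (hlim : Tendsto (fun x : ℝ => (x : ℂ) * Z (p + x)) (𝓝[>] 0) (𝓝 (r : ℂ)))
    {s : ℂ} (hs : 0 < s.re) :
    r * (s.re / Complex.normSq (s - p)) ≤ (Z s).re := by
  have hx : Tendsto (fun x : ℝ => (x : ℂ)) (𝓝[>] 0) (𝓝 0) := by
    have : Tendsto (fun x : ℝ => (x : ℂ)) (𝓝 0) (𝓝 ((0 : ℝ) : ℂ)) :=
      Complex.continuous_ofReal.tendsto 0
    simpa using this.mono_left nhdsWithin_le_nhds
  have hcp : conj p = -p := by
    apply Complex.ext <;> simp [hp]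
  have hlimre : Tendsto (fun x : ℝ => ((x : ℂ) * Z (p + x)).re) (𝓝[>] 0) (𝓝 r) := by
    exact (Complex.continuous_re.tendsto _).comp hlim
  have hL : Tendsto (fun x : ℝ => s.re * Complex.normSq (x * Z s + conj (x * Z (p + x))))
      (𝓝[>] 0) (𝓝 (s.re * Complex.normSq (0 * Z s + conj (r : ℂ)))) := by
    refine Tendsto.const_mul _ ((Complex.continuous_normSq.tendsto _).comp ?_)
    exact (hx.mul_const _).add ((Complex.continuous_conj.tendsto _).comp hlim)
  have hR : Tendsto (fun x : ℝ => (Z s).re * ((x : ℂ) * Z (p + x)).re *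
      Complex.normSq (s + conj p + x)) (𝓝[>] 0)
      (𝓝 ((Z s).re * r * Complex.normSq (s + conj p + 0))) := by
    refine (hlimre.const_mul _).mul ((Complex.continuous_normSq.tendsto _).comp ?_)
    exact hx.const_add _
  have hle : s.re * Complex.normSq (0 * Z s + conj (r : ℂ)) ≤
      (Z s).re * r * Complex.normSq (s + conj p + 0) := by
    refine le_of_tendsto_of_tendsto hL hR ?_
    filter_upwards [self_mem_nhdsWithin, hlimre.eventually (lt_mem_nhds hr)] with x hx0 hx1
    have hx0 : 0 < x := hx0
    have hZw : 0 < (Z (p + x)).re := by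
      rw [Complex.re_ofReal_mul] at hx1
      exact pos_of_mul_pos_right hx1 hx0.le
    have h := schwarz_pick_rightHalfPlane hZ hre hs (w := p + x) (by simpa [hp] using hx0) hZw
    have e : (x : ℂ) * Z s + conj (x * Z (p + x)) = x * (Z s + conj (Z (p + x))) := by
      simp; ring
    rw [e, map_mul, Complex.normSq_ofReal, Complex.re_ofReal_mul]
    have e2 : s + conj p + x = s + conj (p + x) := by simp; ring
    rw [e2]
    have hw : (p + (x : ℂ)).re = x := by simp [hp]
    rw [hw] at h
    nlinarith [mul_le_mul_of_nonneg_left h hx0.le]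
  have hsp : s - p ≠ 0 := by
    intro h
    have := congrArg Complex.re h
    simp only [Complex.sub_re, Complex.zero_re, hp] at this
    linarith
  have hN : 0 < Complex.normSq (s - p) := Complex.normSq_pos.mpr hsp
  rw [hcp] at hle
  simp only [zero_mul, zero_add, add_zero, Complex.conj_ofReal, Complex.normSq_ofReal] at hle
  rw [← sub_eq_add_neg] at hle
  rw [← mul_div_assoc, div_le_iff₀ hN]
  have := le_of_mul_le_mul_left (a := r) (b := r * s.re)
    (c := (Z s).re * Complex.normSq (s - p)) (by linarith) hr
  linarith

/-- Finitely many boundary atoms: each step of the induction subtracts one term `r / (s - p)`, which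
by Julia's lemma keeps the real part nonnegative and does not change the other atoms. -/
theorem sum_atoms_le_re {ι : Type*} (T : Finset ι) (p : ι → ℂ) (r : ι → ℝ)
    (hp : ∀ i ∈ T, (p i).re = 0) (hr : ∀ i ∈ T, 0 < r i) (hinj : Set.InjOn p T) :
    ∀ {Z : ℂ → ℂ}, DifferentiableOn ℂ Z {s | 0 < s.re} → (∀ s : ℂ, 0 < s.re → 0 ≤ (Z s).re) →
    (∀ i ∈ T, Tendsto (fun x : ℝ => (x : ℂ) * Z (p i + x)) (𝓝[>] 0) (𝓝 (r i : ℂ))) →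
    ∀ {s : ℂ}, 0 < s.re → ∑ i ∈ T, r i * (s.re / Complex.normSq (s - p i)) ≤ (Z s).re := by
  classical
  induction T using Finset.induction_on with
  | empty => intro Z _ hre _ s hs; simpa using hre s hs
  | insert a T ha ih =>
    intro Z hZ hre hlim s hs
    have hpa := hp a (Finset.mem_insert_self a T)
    have hne : ∀ s : ℂ, 0 < s.re → s - p a ≠ 0 := by
      intro s hs h
      have := congrArg Complex.re h
      simp only [Complex.sub_re, Complex.zero_re, hpa] at this
      linarith
    have hratom : ∀ s : ℂ, ((r a : ℂ) / (s - p a)).re = r a * (s.re / Complex.normSq (s - p a)) := by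
      intro s
      rw [div_eq_mul_inv, Complex.re_ofReal_mul, Complex.inv_re, Complex.sub_re, hpa, sub_zero]
    have hstep := ih (fun i hi => hp i (Finset.mem_insert_of_mem hi))
      (fun i hi => hr i (Finset.mem_insert_of_mem hi))
      (hinj.mono (by simp)) (Z := fun s => Z s - r a / (s - p a))
      (hZ.sub (DifferentiableOn.div (by fun_prop) (by fun_prop) hne))
      (fun s hs => by
        rw [Complex.sub_re, hratom, sub_nonneg]
        exact julia_rightHalfPlane hZ hre hpa (hr a (Finset.mem_insert_self a T))
          (hlim a (Finset.mem_insert_self a T)) hs)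
      (fun i hi => by
        have hia : p i - p a ≠ 0 := by
          rw [sub_ne_zero]
          intro h
          exact ha (hinj (Finset.mem_coe.2 (Finset.mem_insert_of_mem hi))
            (Finset.mem_coe.2 (Finset.mem_insert_self a T)) h ▸ hi)
        have hc : ContinuousAt (fun x : ℝ => (x : ℂ) * (r a / (p i + x - p a))) 0 := by
          refine Complex.continuous_ofReal.continuousAt.mul (ContinuousAt.div ?_ ?_ ?_)
          · fun_prop
          · fun_prop
          · simpa using hia
        have hc' : Tendsto (fun x : ℝ => (x : ℂ) * (r a / (p i + x - p a))) (𝓝[>] 0) (𝓝 0) := by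
          simpa using hc.tendsto.mono_left nhdsWithin_le_nhds
        have := (hlim i (Finset.mem_insert_of_mem hi)).sub hc'
        rw [sub_zero] at this
        exact this.congr fun x => by ring)
      hs
    rw [Finset.sum_insert ha]
    rw [Complex.sub_re, hratom] at hstep
    linarith

/-! ### Dressed modes as poles of the impedance -/

/-- Admittance seen by a current source across the junction: the environment `Y` in parallel with
the linear inductance `L`. Its zeros on the imaginary axis are the dressed modes. -/
noncomputable def totalAdmittance (Y : ℂ → ℂ) (L : ℝ) (s : ℂ) : ℂ := Y s + 1 / ((L : ℂ) * s)

/-- Residue at `i ω` of the impedance `1 / totalAdmittance Y L`. The definition through the slope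
agrees with it at dressed modes, see `IsPositiveReal.tendsto_impedance`. -/
noncomputable def modeResidue (Y : ℂ → ℂ) (ω : ℝ) : ℝ := ω / susceptanceSlope Y ω

variable {Y : ℂ → ℂ} {L : ℝ}

theorem re_inductor (L : ℝ) (s : ℂ) :
    (1 / ((L : ℂ) * s)).re = s.re / (L * Complex.normSq s) := by
  rw [one_div, mul_inv, ← Complex.ofReal_inv, Complex.re_ofReal_mul, Complex.inv_re]
  rw [div_eq_mul_inv, div_eq_mul_inv, mul_inv]
  ring

theorem ne_zero_of_re_pos {s : ℂ} (hs : 0 < s.re) : s ≠ 0 := by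
  rintro rfl
  simp at hs

theorem IsPositiveReal.re_totalAdmittance_ge (hY : IsPositiveReal Y) {s : ℂ} (hs : 0 < s.re) :
    s.re / (L * Complex.normSq s) ≤ (totalAdmittance Y L s).re := by
  rw [totalAdmittance, Complex.add_re, re_inductor]
  linarith [hY.re_nonneg s hs]

theorem IsPositiveReal.re_totalAdmittance_pos (hY : IsPositiveReal Y) (hL : 0 < L) {s : ℂ}
    (hs : 0 < s.re) : 0 < (totalAdmittance Y L s).re :=
  lt_of_lt_of_le
    (div_pos hs (mul_pos hL (Complex.normSq_pos.mpr (ne_zero_of_re_pos hs))))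
    (hY.re_totalAdmittance_ge hs)

theorem IsPositiveReal.differentiableOn_impedance (hY : IsPositiveReal Y) (hL : 0 < L) :
    DifferentiableOn ℂ (fun s => (totalAdmittance Y L s)⁻¹) {s | 0 < s.re} := by
  refine DifferentiableOn.inv (hY.analytic.differentiableOn.add
    (DifferentiableOn.div (by fun_prop) (by fun_prop) fun s hs => ?_))
    fun s hs => ne_zero_of_re_pos (hY.re_totalAdmittance_pos hL hs)
  exact mul_ne_zero (Complex.ofReal_ne_zero.mpr hL.ne') (ne_zero_of_re_pos hs)

theorem IsPositiveReal.re_impedance_nonneg (hY : IsPositiveReal Y) (hL : 0 < L) {s : ℂ}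
    (hs : 0 < s.re) : 0 ≤ ((totalAdmittance Y L s)⁻¹).re := by
  rw [Complex.inv_re]
  exact div_nonneg (hY.re_totalAdmittance_pos hL hs).le (Complex.normSq_nonneg _)

/-- A function with nonnegative real part in the right half-plane that vanishes at a boundary point
has there a derivative that maps the half-plane to its closure, i.e. a nonnegative real one. -/
theorem derivative_nonneg_of_re_nonneg {F : ℂ → ℂ} {p a : ℂ} (hp : p.re = 0)
    (hF : HasDerivAt F a p) (hF0 : F p = 0) (hre : ∀ s : ℂ, 0 < s.re → 0 ≤ (F s).re) :
    0 ≤ a.re ∧ a.im = 0 := by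
  have hdir : ∀ y : ℝ, 0 ≤ (a * (1 + y * Complex.I)).re := by
    intro y
    have h1 : HasDerivAt (fun t : ℝ => p + (t : ℂ) * (1 + y * Complex.I))
        (1 + y * Complex.I) 0 := by
      simpa using ((hasDerivAt_id (0 : ℝ)).ofReal_comp.mul_const (1 + y * Complex.I)).const_add p
    have h2 : HasDerivAt (fun t : ℝ => F (p + (t : ℂ) * (1 + y * Complex.I)))
        (a * (1 + y * Complex.I)) 0 :=
      HasDerivAt.comp (h₂ := F) (0 : ℝ) (by simpa using hF) h1
    have h3 := (hasDerivAt_iff_tendsto_slope.mp h2).mono_left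
      (nhdsWithin_mono (0 : ℝ) (s := Set.Ioi 0) fun t ht => (ne_of_gt ht : t ≠ 0))
    have h4 := (Complex.continuous_re.tendsto _).comp h3
    refine ge_of_tendsto h4 ?_
    filter_upwards [self_mem_nhdsWithin] with t ht
    have ht : 0 < t := ht
    simp only [Function.comp_apply, slope_def_module, Complex.ofReal_zero, zero_mul, add_zero, hF0,
      sub_zero, Complex.smul_re, smul_eq_mul]
    refine mul_nonneg (by positivity) (hre _ ?_)
    simpa [hp] using ht
  have hlin : ∀ y : ℝ, 0 ≤ a.re - y * a.im := by
    intro y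
    have := hdir y
    simp at this
    linarith
  refine ⟨by simpa using hlin 0, ?_⟩
  by_contra h
  have := hlin ((a.re + 1) / a.im)
  rw [div_mul_cancel₀ _ h] at this
  linarith

theorem totalAdmittance_dressed {ω : ℝ} (hω : ω ∈ dressedFrequencies Y L) :
    totalAdmittance Y L (ω * Complex.I) = 0 := by
  obtain ⟨h0, -, h⟩ := hω
  have hne : (ω : ℂ) * Complex.I ≠ 0 :=
    mul_ne_zero (Complex.ofReal_ne_zero.mpr h0.ne') Complex.I_ne_zero
  apply (mul_eq_zero.mp _).resolve_left hne
  rw [totalAdmittance, mul_add, ← h]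
  congr 1
  rw [mul_one_div, div_mul_cancel_right₀ hne, one_div]

/-- At a dressed mode the derivative of the total admittance is real, positive, and is the slope of
`ω B(ω)` divided by `ω`. Positivity is strict since the inductor alone contributes
`Re (1 / (L s)) = Re s / (L |s|²)`. -/
theorem IsPositiveReal.hasDerivAt_totalAdmittance (hY : IsPositiveReal Y) (hL : 0 < L) {ω : ℝ}
    (hω : ω ∈ dressedFrequencies Y L) :
    0 < susceptanceSlope Y ω ∧ HasDerivAt (totalAdmittance Y L)
      ((susceptanceSlope Y ω / ω : ℝ) : ℂ) (ω * Complex.I) := by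
  have hzero := totalAdmittance_dressed hω
  obtain ⟨h0, han, -⟩ := hω
  set p : ℂ := ω * Complex.I with hpdef
  have hLc : (L : ℂ) ≠ 0 := Complex.ofReal_ne_zero.mpr hL.ne'
  have hωc : (ω : ℂ) ≠ 0 := Complex.ofReal_ne_zero.mpr h0.ne'
  have hp0 : p ≠ 0 := mul_ne_zero hωc Complex.I_ne_zero
  have hpre : p.re = 0 := by simp [hpdef]
  set b : ℂ := deriv Y p with hb
  have hYd : HasDerivAt Y b p := han.differentiableAt.hasDerivAt
  have hind : HasDerivAt (fun s : ℂ => 1 / ((L : ℂ) * s)) ((1 / (L * ω ^ 2) : ℝ) : ℂ) p := by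
    have h1 := ((hasDerivAt_id p).const_mul (L : ℂ)).fun_inv (mul_ne_zero hLc hp0)
    simp only [id, mul_one] at h1
    have h2 : (-(L : ℂ)) / ((L : ℂ) * p) ^ 2 = ((1 / (L * ω ^ 2) : ℝ) : ℂ) := by
      push_cast
      rw [hpdef, mul_pow, mul_pow, Complex.I_sq]
      field_simp
    rw [h2] at h1
    simpa only [one_div] using h1
  have hT : HasDerivAt (totalAdmittance Y L) (b + ((1 / (L * ω ^ 2) : ℝ) : ℂ)) p := hYd.add hind
  -- the derivative of the inductor term is explicit and positive, so `0 ≤ Y'(p)` is what is left;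
  -- `Y p` is purely imaginary, so subtracting it does not affect the real part
  have hYp : Y p = -(1 / ((L : ℂ) * p)) := by
    rw [totalAdmittance] at hzero
    exact eq_neg_of_add_eq_zero_left hzero
  have hb' := derivative_nonneg_of_re_nonneg (F := fun s => Y s - Y p) hpre
    (hYd.sub_const _) (sub_self _) (fun s hs => by
      have : (Y p).re = 0 := by
        rw [hYp, Complex.neg_re, re_inductor, hpre, zero_div, neg_zero]
      rw [Complex.sub_re, this, sub_zero]
      exact hY.re_nonneg s hs)
  have hslope : susceptanceSlope Y ω = ω * (b.re + 1 / (L * ω ^ 2)) := by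
    have h1 : HasDerivAt (fun t : ℝ => Y (t * Complex.I)) (b * Complex.I) ω := by
      have h2 : HasDerivAt (fun t : ℝ => (t : ℂ) * Complex.I) Complex.I ω := by
        simpa using (hasDerivAt_id ω).ofReal_comp.mul_const Complex.I
      exact HasDerivAt.comp (h₂ := Y) ω hYd h2
    have h3 : HasDerivAt (susceptance Y) (b * Complex.I).im ω :=
      Complex.imCLM.hasFDerivAt.comp_hasDerivAt ω h1
    have h4 : HasDerivAt (fun w : ℝ => w * susceptance Y w)
        (1 * susceptance Y ω + ω * (b * Complex.I).im) ω := (hasDerivAt_id ω).mul h3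
    have h5 : susceptance Y ω = 1 / (L * ω) := by
      rw [susceptance, ← hpdef, hYp]
      have : -(1 / ((L : ℂ) * p)) = ((1 / (L * ω) : ℝ) : ℂ) * Complex.I := by
        push_cast
        rw [hpdef]
        field_simp
        simp
      rw [this, Complex.im_ofReal_mul, Complex.I_im, mul_one]
    rw [susceptanceSlope, h4.deriv, h5]
    simp only [Complex.mul_im, Complex.I_re, Complex.I_im, mul_one, mul_zero, one_mul,
      add_zero]
    field_simp
    ring
  have hbreal : b = (b.re : ℂ) := Complex.ext rfl (by simpa using hb'.2)
  refine ⟨?_, ?_⟩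
  · rw [hslope]
    have : 0 < 1 / (L * ω ^ 2) := by positivity
    exact mul_pos h0 (by linarith [hb'.1])
  · rw [hslope, mul_div_cancel_left₀ _ h0.ne']
    rw [hbreal] at hT
    exact_mod_cast hT

theorem IsPositiveReal.modeResidue_pos (hY : IsPositiveReal Y) (hL : 0 < L) {ω : ℝ}
    (hω : ω ∈ dressedFrequencies Y L) : 0 < modeResidue Y ω :=
  div_pos hω.1 (hY.hasDerivAt_totalAdmittance hL hω).1

theorem IsPositiveReal.tendsto_impedance (hY : IsPositiveReal Y) (hL : 0 < L) {ω : ℝ}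
    (hω : ω ∈ dressedFrequencies Y L) :
    Tendsto (fun x : ℝ => (x : ℂ) * (totalAdmittance Y L (ω * Complex.I + x))⁻¹) (𝓝[>] 0)
      (𝓝 (modeResidue Y ω : ℂ)) := by
  obtain ⟨hpos, hd⟩ := hY.hasDerivAt_totalAdmittance hL hω
  have hne : ((susceptanceSlope Y ω / ω : ℝ) : ℂ) ≠ 0 :=
    Complex.ofReal_ne_zero.mpr (div_pos hpos hω.1).ne'
  have h1 : HasDerivAt (fun t : ℝ => (ω : ℂ) * Complex.I + (t : ℂ)) 1 0 := by
    simpa using (hasDerivAt_id (0 : ℝ)).ofReal_comp.const_add ((ω : ℂ) * Complex.I)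
  have h2 : HasDerivAt (fun t : ℝ => totalAdmittance Y L (ω * Complex.I + t))
      (((susceptanceSlope Y ω / ω : ℝ) : ℂ) * 1) 0 :=
    HasDerivAt.comp (h₂ := totalAdmittance Y L) (0 : ℝ) (by simpa using hd) h1
  rw [mul_one] at h2
  have h3 := (hasDerivAt_iff_tendsto_slope.mp h2).mono_left
    (nhdsWithin_mono (0 : ℝ) (s := Set.Ioi 0) fun t ht => (ne_of_gt ht : t ≠ 0))
  have h4 := h3.inv₀ hne
  have e : ((susceptanceSlope Y ω / ω : ℝ) : ℂ)⁻¹ = (modeResidue Y ω : ℂ) := by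
    rw [modeResidue, ← Complex.ofReal_inv, inv_div]
  rw [e] at h4
  refine h4.congr fun x => ?_
  simp only [slope_def_module, sub_zero, Complex.ofReal_zero, add_zero, totalAdmittance_dressed hω,
    Complex.real_smul, mul_inv, Complex.ofReal_inv, inv_inv]

/-- Any finite set of dressed modes accounts for part of the dissipation of the impedance in the
open half-plane. -/
theorem IsPositiveReal.sum_modeResidue_le (hY : IsPositiveReal Y) (hL : 0 < L) (T : Finset ℝ)
    (hT : ∀ ω ∈ T, ω ∈ dressedFrequencies Y L) {s : ℂ} (hs : 0 < s.re) :
    ∑ ω ∈ T, modeResidue Y ω * (s.re / Complex.normSq (s - ω * Complex.I)) ≤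
      ((totalAdmittance Y L s)⁻¹).re :=
  sum_atoms_le_re T (fun ω => ω * Complex.I) (modeResidue Y) (fun ω _ => by simp)
    (fun ω hω => hY.modeResidue_pos hL (hT ω hω))
    (fun x _ y _ h => by simpa using h)
    (hY.differentiableOn_impedance hL) (fun s hs => hY.re_impedance_nonneg hL hs)
    (fun ω hω => hY.tendsto_impedance hL (hT ω hω)) hs

/-- Sum rule at low frequency, from `Re Z(x) ≤ L x` for real `x → 0`. -/
theorem IsPositiveReal.sum_modeResidue_div_sq_le (hY : IsPositiveReal Y) (hL : 0 < L)
    (T : Finset ℝ) (hT : ∀ ω ∈ T, ω ∈ dressedFrequencies Y L) :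
    ∑ ω ∈ T, modeResidue Y ω / ω ^ 2 ≤ L := by
  have hlim : Tendsto (fun x : ℝ => ∑ ω ∈ T, modeResidue Y ω / (x ^ 2 + ω ^ 2)) (𝓝[>] 0)
      (𝓝 (∑ ω ∈ T, modeResidue Y ω / ω ^ 2)) := by
    refine tendsto_finsetSum T fun ω hω => ?_
    have hω0 : ω ≠ 0 := (hT ω hω).1.ne'
    have hc : ContinuousAt (fun x : ℝ => modeResidue Y ω / (x ^ 2 + ω ^ 2)) 0 :=
      ContinuousAt.div (by fun_prop) (by fun_prop) (by simpa using hω0)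
    simpa using hc.tendsto.mono_left nhdsWithin_le_nhds
  refine le_of_tendsto hlim ?_
  filter_upwards [self_mem_nhdsWithin] with x hx
  have hx : 0 < x := hx
  have hxs : 0 < (x : ℂ).re := by simpa using hx
  have h1 := hY.sum_modeResidue_le hL T hT hxs
  have hA := hY.re_totalAdmittance_ge (L := L) hxs
  have hApos := hY.re_totalAdmittance_pos hL hxs
  have e1 : ∑ ω ∈ T, modeResidue Y ω * ((x : ℂ).re / Complex.normSq ((x : ℂ) - ω * Complex.I)) =
      x * ∑ ω ∈ T, modeResidue Y ω / (x ^ 2 + ω ^ 2) := by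
    rw [Finset.mul_sum]
    refine Finset.sum_congr rfl fun ω _ => ?_
    have : Complex.normSq ((x : ℂ) - ω * Complex.I) = x ^ 2 + ω ^ 2 := by
      rw [Complex.normSq_apply]
      simp
      ring
    rw [this, Complex.ofReal_re]
    ring
  have e2 : ((totalAdmittance Y L x)⁻¹).re ≤ x * L := by
    refine (Complex.re_le_norm _).trans ?_
    rw [norm_inv]
    have h2 : (x * L)⁻¹ ≤ ‖totalAdmittance Y L x‖ := by
      refine le_trans (le_of_eq ?_) (hA.trans (Complex.re_le_norm _))
      rw [Complex.normSq_ofReal, Complex.ofReal_re]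
      field_simp
    exact inv_le_of_inv_le₀ (by positivity) h2
  rw [e1] at h1
  exact le_of_mul_le_mul_left (h1.trans e2) hx

/-! ### Decay of the residues at high frequency -/

/-- If `Y` is asymptotic to `s C` on the imaginary axis itself, the capacitor shorts the junction at
high frequency and the dressed frequencies are bounded. -/
theorem dressedFrequencies_bounded_of_axis {C : ℝ} (hC : 0 < C) (hL : 0 < L) {c W₀ : ℝ}
    (hbound : ∀ v : ℝ, W₀ ≤ v → ‖Y (v * Complex.I) - v * Complex.I * C‖ ≤ c) {ω : ℝ}
    (hω : ω ∈ dressedFrequencies Y L) : ω < max (max W₀ 1) ((c + 1 / L) / C + 1) := by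
  by_contra! hle
  obtain ⟨⟨h1, h2⟩, h3⟩ : (W₀ ≤ ω ∧ 1 ≤ ω) ∧ (c + 1 / L) / C + 1 ≤ ω := by
    simpa only [max_le_iff] using hle
  have hz := totalAdmittance_dressed hω
  have hYp : Y (ω * Complex.I) = -(1 / ((L : ℂ) * (ω * Complex.I))) :=
    eq_neg_of_add_eq_zero_left hz
  have hYn : ‖Y (ω * Complex.I)‖ ≤ 1 / L := by
    rw [hYp, norm_neg, norm_div, norm_mul, norm_mul, Complex.norm_I, mul_one, norm_one,
      Complex.norm_real, Complex.norm_real, Real.norm_of_nonneg hL.le,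
      Real.norm_of_nonneg hω.1.le]
    exact one_div_le_one_div_of_le hL (by nlinarith)
  have hn : ‖(ω : ℂ) * Complex.I * C‖ = ω * C := by
    rw [norm_mul, norm_mul, Complex.norm_I, mul_one, Complex.norm_real, Complex.norm_real,
      Real.norm_of_nonneg hC.le, Real.norm_of_nonneg hω.1.le]
  have h4 : ω * C ≤ c + 1 / L := by
    rw [← hn]
    have := norm_sub_norm_le ((ω : ℂ) * Complex.I * C) (Y (ω * Complex.I))
    rw [norm_sub_rev] at this
    linarith [hbound ω h1]
  have h5 : (c + 1 / L) / C < ω := by linarith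
  rw [div_lt_iff₀ hC] at h5
  linarith

/-- On a line inside the half-plane on which `Y` is asymptotic to `s C`, the real part of the
impedance decays like `v⁻²`, because `Z = 1 / D` has `Re Z = Re D / |D|²` with `Re D` bounded. -/
theorem re_impedance_le {C : ℝ} (hC : 0 < C) (hL : 0 < L) {σ c v : ℝ} (hσ : 0 < σ) (hc : 0 ≤ c)
    (hv : 0 < v) (hvc : 2 * (c + 1 / (L * σ)) / C ≤ v)
    (hbound : ‖Y (σ + v * Complex.I) - (σ + v * Complex.I) * C‖ ≤ c) :
    ((totalAdmittance Y L (σ + v * Complex.I))⁻¹).re ≤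
      (σ * C + (c + 1 / (L * σ))) * 4 / C ^ 2 / v ^ 2 := by
  set s : ℂ := σ + v * Complex.I with hs
  set D := totalAdmittance Y L s with hD
  have hsre : s.re = σ := by simp [hs]
  have hsim : s.im = v := by simp [hs]
  have hsσ : σ ≤ ‖s‖ := hsre ▸ Complex.re_le_norm s
  have hsv : v ≤ ‖s‖ := hsim ▸ Complex.im_le_norm s
  have hE : ‖D - s * C‖ ≤ c + 1 / (L * σ) := by
    have : D - s * C = (Y s - s * C) + 1 / ((L : ℂ) * s) := by
      rw [hD, totalAdmittance]; ring
    rw [this]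
    refine (norm_add_le _ _).trans (add_le_add hbound ?_)
    rw [norm_div, norm_mul, norm_one, Complex.norm_real, Real.norm_of_nonneg hL.le]
    exact one_div_le_one_div_of_le (by positivity) (by gcongr)
  have hc' : 0 ≤ c + 1 / (L * σ) := by positivity
  have hre : D.re ≤ σ * C + (c + 1 / (L * σ)) := by
    have h1 := (Complex.re_le_norm (D - s * C)).trans hE
    rw [Complex.sub_re, Complex.re_mul_ofReal, hsre] at h1
    linarith
  have hnorm : v * C / 2 ≤ ‖D‖ := by
    have h1 := norm_sub_norm_le (s * C) D
    rw [norm_sub_rev, norm_mul, Complex.norm_real, Real.norm_of_nonneg hC.le] at h1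
    rw [div_le_iff₀ hC] at hvc
    nlinarith [mul_le_mul_of_nonneg_right hsv hC.le]
  have hvC : 0 < v * C / 2 := by positivity
  rw [Complex.inv_re, Complex.normSq_eq_norm_sq]
  calc D.re / ‖D‖ ^ 2 ≤ (σ * C + (c + 1 / (L * σ))) / ‖D‖ ^ 2 := by gcongr
    _ ≤ (σ * C + (c + 1 / (L * σ))) / (v * C / 2) ^ 2 := by gcongr
    _ = (σ * C + (c + 1 / (L * σ))) * 4 / C ^ 2 / v ^ 2 := by field_simp; ring

/-- The residues in a window of unit length at height `v` add up to `O(v⁻²)`. -/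
theorem IsPositiveReal.sum_modeResidue_window_le (hY : IsPositiveReal Y) {C : ℝ} (hC : 0 < C)
    (hL : 0 < L) (hYC : HasShuntCapacitance Y C) :
    ∃ A W : ℝ, 0 ≤ A ∧ 1 ≤ W ∧ ∀ v : ℝ, W ≤ v → ∀ T : Finset ℝ,
      (∀ ω ∈ T, ω ∈ dressedFrequencies Y L ∧ v ≤ ω ∧ ω ≤ v + 1) →
      ∑ ω ∈ T, modeResidue Y ω ≤ A / v ^ 2 := by
  obtain ⟨σ, hσ, hO⟩ := hYC
  obtain ⟨c, hc0, hc⟩ := hO.exists_pos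
  obtain ⟨W₀, hW₀⟩ := eventually_atTop.mp hc.bound
  have hbound : ∀ v : ℝ, W₀ ≤ v → ‖Y (σ + v * Complex.I) - (σ + v * Complex.I) * C‖ ≤ c :=
    fun v hv => by simpa using hW₀ v hv
  rcases hσ.eq_or_lt with rfl | hσ
  · refine ⟨0, max (max W₀ 1) ((c + 1 / L) / C + 1), le_rfl,
      (le_max_right _ _).trans (le_max_left _ _), fun v hv T hT => ?_⟩
    have hempty : T = ∅ := by
      refine Finset.eq_empty_of_forall_notMem fun ω hω => ?_
      obtain ⟨h1, h2, -⟩ := hT ω hω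
      have := dressedFrequencies_bounded_of_axis hC hL (fun v hv => by simpa using hbound v hv) h1
      linarith
    simp [hempty]
  · set B : ℝ := (σ * C + (c + 1 / (L * σ))) * 4 / C ^ 2 with hB
    refine ⟨B * ((σ ^ 2 + 1) / σ), max (max W₀ 1) (2 * (c + 1 / (L * σ)) / C), by positivity,
      (le_max_right _ _).trans (le_max_left _ _), fun v hv T hT => ?_⟩
    obtain ⟨⟨h1, h2⟩, h3⟩ : (W₀ ≤ v ∧ 1 ≤ v) ∧ 2 * (c + 1 / (L * σ)) / C ≤ v := by
      simpa only [max_le_iff] using hv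
    have hv0 : 0 < v := by linarith
    have hsre : ((σ : ℂ) + v * Complex.I).re = σ := by simp
    have hsum := hY.sum_modeResidue_le hL T (fun ω hω => (hT ω hω).1)
      (s := σ + v * Complex.I) (by rw [hsre]; exact hσ)
    have hZ := re_impedance_le hC hL hσ hc0.le hv0 h3 (hbound v h1)
    have hlow : (∑ ω ∈ T, modeResidue Y ω) * (σ / (σ ^ 2 + 1)) ≤
        ∑ ω ∈ T, modeResidue Y ω * (((σ : ℂ) + v * Complex.I).re /
          Complex.normSq ((σ : ℂ) + v * Complex.I - ω * Complex.I)) := by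
      rw [Finset.sum_mul]
      refine Finset.sum_le_sum fun ω hω => ?_
      obtain ⟨hω1, hω2, hω3⟩ := hT ω hω
      have hn : Complex.normSq ((σ : ℂ) + v * Complex.I - ω * Complex.I) = σ ^ 2 + (v - ω) ^ 2 := by
        rw [Complex.normSq_apply]
        simp
        ring
      rw [hn, hsre]
      refine mul_le_mul_of_nonneg_left ?_ (hY.modeResidue_pos hL hω1).le
      exact div_le_div_of_nonneg_left hσ.le (by positivity) (by nlinarith)
    have hfin := hlow.trans (hsum.trans hZ)
    rw [← hB, ← le_div_iff₀ (by positivity)] at hfin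
    refine hfin.trans (le_of_eq ?_)
    field_simp

/-- Sums with weight `ω ^ q`, `q < 1`, of a nonnegative sequence whose unit windows at height `v`
have mass `O(v⁻²)`; the bound is uniform over the finite sets of frequencies above `N`. -/
theorem sum_rpow_le_of_window {S : Set ℝ} {r : ℝ → ℝ} (hr : ∀ ω ∈ S, 0 ≤ r ω) {A : ℝ} {N : ℕ}
    (hA : 0 ≤ A) (hN : 1 ≤ N)
    (hwin : ∀ v : ℝ, (N : ℝ) ≤ v → ∀ T : Finset ℝ, (∀ ω ∈ T, ω ∈ S ∧ v ≤ ω ∧ ω ≤ v + 1) →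
      ∑ ω ∈ T, r ω ≤ A / v ^ 2) {q : ℝ} (hq0 : 0 ≤ q) (hq1 : q < 1) :
    ∃ c : ℝ, ∀ T : Finset ℝ, (∀ ω ∈ T, ω ∈ S ∧ (N : ℝ) ≤ ω) → ∑ ω ∈ T, r ω * ω ^ q ≤ c := by
  have hsummable : Summable fun j : ℕ => 4 * A * ((j + 1 : ℕ) : ℝ) ^ (q - 2) :=
    ((summable_nat_add_iff 1).mpr (Real.summable_nat_rpow.mpr (by linarith))).mul_left _
  refine ⟨∑' j : ℕ, 4 * A * ((j + 1 : ℕ) : ℝ) ^ (q - 2), fun T hT => ?_⟩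
  classical
  rw [← Finset.sum_fiberwise_of_maps_to (s := T) (t := T.image fun ω => ⌊ω⌋₊)
    (g := fun ω => ⌊ω⌋₊) (fun ω hω => Finset.mem_image_of_mem _ hω)]
  refine le_trans (Finset.sum_le_sum fun j hj => ?_)
    (hsummable.sum_le_tsum _ fun j _ => by positivity)
  obtain ⟨ω₀, hω₀, hj⟩ := Finset.mem_image.mp hj
  have hNj : N ≤ j := hj ▸ Nat.le_floor (hT ω₀ hω₀).2
  have hj1 : (1 : ℝ) ≤ j := by exact_mod_cast hN.trans hNj
  have hfib : ∀ ω ∈ T.filter (fun ω => ⌊ω⌋₊ = j), ω ∈ S ∧ (j : ℝ) ≤ ω ∧ ω ≤ (j : ℝ) + 1 := by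
    intro ω hω
    obtain ⟨hωT, hωj⟩ := Finset.mem_filter.mp hω
    obtain ⟨hS, hNω⟩ := hT ω hωT
    have hω0 : 0 ≤ ω := (Nat.cast_nonneg N).trans hNω
    rw [← hωj]
    exact ⟨hS, Nat.floor_le hω0, (Nat.lt_floor_add_one ω).le⟩
  have hjp : (0 : ℝ) < ((j + 1 : ℕ) : ℝ) := by positivity
  calc ∑ ω ∈ T.filter (fun ω => ⌊ω⌋₊ = j), r ω * ω ^ q
      ≤ ∑ ω ∈ T.filter (fun ω => ⌊ω⌋₊ = j), r ω * ((j + 1 : ℕ) : ℝ) ^ q := by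
        refine Finset.sum_le_sum fun ω hω => ?_
        obtain ⟨hS, h1, h2⟩ := hfib ω hω
        refine mul_le_mul_of_nonneg_left ?_ (hr ω hS)
        exact Real.rpow_le_rpow (by linarith) (by push_cast; exact h2) hq0
    _ = (∑ ω ∈ T.filter (fun ω => ⌊ω⌋₊ = j), r ω) * ((j + 1 : ℕ) : ℝ) ^ q := by
        rw [Finset.sum_mul]
    _ ≤ A / (j : ℝ) ^ 2 * ((j + 1 : ℕ) : ℝ) ^ q := by
        gcongr
        exact hwin j (by exact_mod_cast hNj) _ hfib
    _ ≤ 4 * A / ((j + 1 : ℕ) : ℝ) ^ 2 * ((j + 1 : ℕ) : ℝ) ^ q := by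
        refine mul_le_mul_of_nonneg_right ?_ (by positivity)
        rw [div_le_div_iff₀ (by positivity) (by positivity)]
        push_cast
        have hj2 : ((j : ℝ) + 1) ^ 2 ≤ 4 * (j : ℝ) ^ 2 := by nlinarith
        nlinarith [mul_le_mul_of_nonneg_left hj2 hA]
    _ = 4 * A * ((j + 1 : ℕ) : ℝ) ^ (q - 2) := by
        rw [Real.rpow_sub hjp, Real.rpow_two]
        ring

/-! ### Participation, zero-point flux and coupling -/

theorem dimensionlessCoupling_sq {hbar e : ℝ} (hhbar : 0 < hbar) {ω : ℝ} (hω : 0 < ω)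
    (hslope : 0 < susceptanceSlope Y ω) :
    dimensionlessCoupling hbar e Y ω ^ 2 =
      hbar / reducedFluxQuantum hbar e ^ 2 * (modeResidue Y ω / ω) := by
  rw [dimensionlessCoupling, zeroPointFlux, junctionParticipation, div_pow, mul_pow,
    Real.sq_sqrt (by positivity), Real.sq_sqrt (by positivity), modeResidue]
  field_simp

/-- Summation over all dressed modes. Below the cutoff the sum rule for `r / ω²` applies, which also
covers modes that accumulate at a finite frequency or at zero; above it, the decay of the window
sums. -/
theorem IsPositiveReal.summable_modeResidue_mul (hY : IsPositiveReal Y) {C : ℝ} (hC : 0 < C)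
    (hL : 0 < L) (hYC : HasShuntCapacitance Y C) {f : ℝ → ℝ} {k : ℝ} (hk : k < 2)
    (hf : f =O[atTop] fun ω : ℝ => ω ^ k)
    (hfb : ∀ R : ℝ, ∃ M : ℝ, ∀ ω ∈ dressedFrequencies Y L, ω ≤ R → |f ω| ≤ M) :
    Summable fun ω : dressedFrequencies Y L => modeResidue Y ω / ω * |f ω| := by
  obtain ⟨A, W, hA, -, hwin⟩ := hY.sum_modeResidue_window_le hC hL hYC
  obtain ⟨K, hK0, hK⟩ := hf.exists_pos
  obtain ⟨W₁, hW₁⟩ := eventually_atTop.mp hK.bound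
  obtain ⟨N, hN⟩ := exists_nat_ge (max (max W W₁) 1)
  obtain ⟨⟨hNW, hNW₁⟩, hN1⟩ : (W ≤ N ∧ W₁ ≤ N) ∧ (1 : ℝ) ≤ N := by
    simpa only [max_le_iff] using hN
  obtain ⟨M, hM⟩ := hfb N
  -- replacing `k` by `max k 1` makes the exponent of the weight nonnegative, so that the weight is
  -- increasing on each window
  have hq : max k 1 - 1 < 1 := by
    have : max k 1 < 2 := max_lt hk (by norm_num)
    linarith
  obtain ⟨c, hc⟩ := sum_rpow_le_of_window (fun ω hω => (hY.modeResidue_pos hL hω).le) hA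
    (by exact_mod_cast hN1) (fun v hv => hwin v (hNW.trans hv))
    (q := max k 1 - 1) (by linarith [le_max_right k 1]) hq
  have hnonneg : ∀ ω ∈ dressedFrequencies Y L, 0 ≤ modeResidue Y ω / ω * |f ω| := fun ω hω =>
    mul_nonneg (div_nonneg (hY.modeResidue_pos hL hω).le hω.1.le) (abs_nonneg _)
  refine summable_of_sum_le (c := N * |M| * L + K * c) (fun ω => hnonneg ω ω.2) fun u => ?_
  classical
  set T : Finset ℝ := u.map (Function.Embedding.subtype _) with hTdef
  have hT : ∀ ω ∈ T, ω ∈ dressedFrequencies Y L := by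
    intro ω hω
    obtain ⟨x, -, rfl⟩ := Finset.mem_map.mp hω
    exact x.2
  have e : ∑ ω ∈ u, modeResidue Y ω / ω * |f ω| = ∑ ω ∈ T, modeResidue Y ω / ω * |f ω| := by
    rw [hTdef, Finset.sum_map]
    rfl
  rw [e, ← Finset.sum_filter_add_sum_filter_not T (fun ω => ω < (N : ℝ))]
  refine add_le_add ?_ ?_
  · calc ∑ ω ∈ T.filter (fun ω => ω < (N : ℝ)), modeResidue Y ω / ω * |f ω|
        ≤ ∑ ω ∈ T.filter (fun ω => ω < (N : ℝ)), N * |M| * (modeResidue Y ω / ω ^ 2) := by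
          refine Finset.sum_le_sum fun ω hω => ?_
          obtain ⟨hωT, hωN⟩ := Finset.mem_filter.mp hω
          have hS := hT ω hωT
          have hω0 := hS.1
          have hr := hY.modeResidue_pos hL hS
          have h1 : |f ω| ≤ |M| := (hM ω hS hωN.le).trans (le_abs_self M)
          calc modeResidue Y ω / ω * |f ω| ≤ modeResidue Y ω / ω * |M| := by gcongr
            _ = ω * |M| * (modeResidue Y ω / ω ^ 2) := by field_simp
            _ ≤ N * |M| * (modeResidue Y ω / ω ^ 2) := by gcongr
      _ = N * |M| * ∑ ω ∈ T.filter (fun ω => ω < (N : ℝ)), modeResidue Y ω / ω ^ 2 := by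
          rw [Finset.mul_sum]
      _ ≤ N * |M| * L := by
          gcongr
          exact hY.sum_modeResidue_div_sq_le hL _ fun ω hω => hT ω (Finset.mem_filter.mp hω).1
  · calc ∑ ω ∈ T.filter (fun ω => ¬ ω < (N : ℝ)), modeResidue Y ω / ω * |f ω|
        ≤ ∑ ω ∈ T.filter (fun ω => ¬ ω < (N : ℝ)), K * (modeResidue Y ω * ω ^ (max k 1 - 1)) := by
          refine Finset.sum_le_sum fun ω hω => ?_
          obtain ⟨hωT, hωN⟩ := Finset.mem_filter.mp hω
          rw [not_lt] at hωN
          have hS := hT ω hωT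
          have hω0 := hS.1
          have hr := hY.modeResidue_pos hL hS
          have h1 : |f ω| ≤ K * ω ^ max k 1 := by
            have h2 := hW₁ ω (hNW₁.trans hωN)
            rw [Real.norm_eq_abs, Real.norm_of_nonneg (Real.rpow_nonneg hω0.le k)] at h2
            refine h2.trans (mul_le_mul_of_nonneg_left ?_ hK0.le)
            exact Real.rpow_le_rpow_of_exponent_le (hN1.trans hωN) (le_max_left k 1)
          calc modeResidue Y ω / ω * |f ω| ≤ modeResidue Y ω / ω * (K * ω ^ max k 1) := by gcongr
            _ = K * (modeResidue Y ω * ω ^ (max k 1 - 1)) := by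
              rw [Real.rpow_sub_one hω0.ne']
              ring
      _ = K * ∑ ω ∈ T.filter (fun ω => ¬ ω < (N : ℝ)), modeResidue Y ω * ω ^ (max k 1 - 1) := by
          rw [Finset.mul_sum]
      _ ≤ K * c := by
          gcongr
          exact hc _ fun ω hω =>
            ⟨hT ω (Finset.mem_filter.mp hω).1, not_lt.mp (Finset.mem_filter.mp hω).2⟩

theorem IsPositiveReal.junctionParticipation_isBigO (hY : IsPositiveReal Y) {C : ℝ} (hC : 0 < C)
    (hL : 0 < L) (hYC : HasShuntCapacitance Y C) :
    (fun ω : ℝ => junctionParticipation Y ω) =O[highFrequencyModes Y L] fun ω : ℝ => ω⁻¹ := by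
  obtain ⟨A, W, hA, -, hwin⟩ := hY.sum_modeResidue_window_le hC hL hYC
  refine IsBigO.of_bound (Real.sqrt (2 * A)) ?_
  rw [highFrequencyModes, eventually_inf_principal]
  filter_upwards [eventually_ge_atTop W] with ω hWω hω
  have h1 := hwin ω hWω {ω} (by simpa using hω)
  rw [Finset.sum_singleton] at h1
  have hω0 := hω.1
  rw [junctionParticipation, Real.norm_of_nonneg (Real.sqrt_nonneg _),
    Real.norm_of_nonneg (inv_nonneg.mpr hω0.le), ← Real.sqrt_sq (inv_nonneg.mpr hω0.le),
    ← Real.sqrt_mul (by positivity)]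
  refine Real.sqrt_le_sqrt ?_
  rw [mul_div_assoc, mul_assoc, inv_pow, ← div_eq_mul_inv]
  exact mul_le_mul_of_nonneg_left h1 zero_le_two

theorem IsPositiveReal.zeroPointFlux_isBigO (hY : IsPositiveReal Y) {C : ℝ} (hC : 0 < C)
    (hL : 0 < L) (hYC : HasShuntCapacitance Y C) {hbar : ℝ} (hhbar : 0 < hbar) :
    (fun ω : ℝ => zeroPointFlux hbar Y ω)
      =O[highFrequencyModes Y L] fun ω : ℝ => ω ^ (-(3 / 2) : ℝ) := by
  have h1 : (fun ω : ℝ => Real.sqrt (hbar / (2 * ω))) =O[highFrequencyModes Y L]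
      fun ω : ℝ => ω ^ (-(1 / 2) : ℝ) := by
    refine IsBigO.of_bound (Real.sqrt (hbar / 2)) ?_
    rw [highFrequencyModes, eventually_inf_principal]
    refine Eventually.of_forall fun ω hω => le_of_eq ?_
    have hω0 := hω.1
    rw [Real.norm_of_nonneg (Real.sqrt_nonneg _), Real.norm_of_nonneg (Real.rpow_nonneg hω0.le _),
      Real.rpow_neg hω0.le, ← Real.sqrt_eq_rpow, ← div_div, Real.sqrt_div (by positivity),
      div_eq_mul_inv]
  refine ((hY.junctionParticipation_isBigO hC hL hYC).mul h1).congr' EventuallyEq.rfl ?_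
  rw [EventuallyEq, highFrequencyModes, eventually_inf_principal]
  refine Eventually.of_forall fun ω hω => ?_
  rw [← Real.rpow_neg_one, ← Real.rpow_add hω.1]
  norm_num

end CircuitQED

theorem theorem6 (hbar e EJ C : ℝ) (Y : ℂ → ℂ)
    (hhbar : 0 < hbar) (he : 0 < e) (hEJ : 0 < EJ) (hC : 0 < C)
    (hY : CircuitQED.IsPositiveReal Y) (hYC : CircuitQED.HasShuntCapacitance Y C) :
    -- the participation formula is meaningful at every dressed mode
    (∀ ω ∈ CircuitQED.dressedFrequencies Y (CircuitQED.josephsonInductance hbar e EJ),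
      0 < CircuitQED.susceptanceSlope Y ω) ∧
    -- (i)
    ((fun ω : ℝ => CircuitQED.junctionParticipation Y ω)
      =O[CircuitQED.highFrequencyModes Y (CircuitQED.josephsonInductance hbar e EJ)]
        (fun ω : ℝ => ω⁻¹)) ∧
    -- (ii)
    ((fun ω : ℝ => CircuitQED.zeroPointFlux hbar Y ω)
      =O[CircuitQED.highFrequencyModes Y (CircuitQED.josephsonInductance hbar e EJ)]
        (fun ω : ℝ => ω ^ (-(3 / 2) : ℝ))) ∧
    -- (iii)
    ((fun ω : ℝ => CircuitQED.dimensionlessCoupling hbar e Y ω)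
      =O[CircuitQED.highFrequencyModes Y (CircuitQED.josephsonInductance hbar e EJ)]
        (fun ω : ℝ => ω ^ (-(3 / 2) : ℝ))) ∧
    -- (iv)
    (∀ (f : ℝ → ℝ) (k : ℝ), k < 2 → f =O[atTop] (fun ω : ℝ => ω ^ k) →
      -- automatic if there are finitely many modes below every frequency
      (∀ R : ℝ, ∃ M : ℝ,
        ∀ ω ∈ CircuitQED.dressedFrequencies Y (CircuitQED.josephsonInductance hbar e EJ),
          ω ≤ R → |f ω| ≤ M) →
      Summable (fun ω : CircuitQED.dressedFrequencies Y
          (CircuitQED.josephsonInductance hbar e EJ) =>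
        |CircuitQED.dimensionlessCoupling hbar e Y (ω : ℝ) ^ 2 * f (ω : ℝ)|)) := by
  have hL : 0 < CircuitQED.josephsonInductance hbar e EJ := by
    rw [CircuitQED.josephsonInductance, CircuitQED.reducedFluxQuantum]
    positivity
  have hflux := hY.zeroPointFlux_isBigO hC hL hYC hhbar
  refine ⟨fun ω hω => (hY.hasDerivAt_totalAdmittance hL hω).1,
    hY.junctionParticipation_isBigO hC hL hYC, hflux, ?_, ?_⟩
  · simpa only [CircuitQED.dimensionlessCoupling, div_eq_inv_mul] using hflux.const_mul_left _
  · intro f k hk hf hfb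
    refine ((hY.summable_modeResidue_mul hC hL hYC hk hf hfb).mul_left
      (hbar / CircuitQED.reducedFluxQuantum hbar e ^ 2)).congr fun ω => ?_
    rw [abs_mul, abs_sq, CircuitQED.dimensionlessCoupling_sq hhbar ω.2.1
      (hY.hasDerivAt_totalAdmittance hL ω.2).1, mul_assoc]
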